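/- Let $\mathcal N=\{1,\dots,n\}$ be a finite set of products and let $\mathcal S$ be any collection of nonempty subsets of $\mathcal N$ (assortments). A marginal distribution model (MDM) consists of deterministic utilities $\nu_1,\dots,\nu_n\in\mathbb R$ and of marginal laws $F_1,\dots,F_n$ on $\mathbb R$, each absolutely continuous, with finite first absolute moment, and with a distribution function that is strictly increasing on its support. Let $\Theta$ be the set of all joint laws of $(\tilde\epsilon_1,\dots,\tilde\epsilon_n)$ with these marginals. For an assortment $S$, the choice probabilities of the MDM are $$p_{i,S}=\mathbb P_{\tilde\epsilon\sim\theta^*}\Big(i=\arg\max_{j\in S}\{\nu_j+\tilde\epsilon_j\}\Big),\qquad i\in S,$$ where $\theta^*\in\Theta$ attains $\sup_{\theta\in\Theta}\mathbb E_{\tilde\epsilon\sim\theta}\big[\max_{i\in S}\{\nu_i+\tilde\epsilon_i\}\big]$. Let $\Delta_S=\{(x_{i,S})_{i\in S}: x_{i,S}\ge 0,\ \sum_{i\in S}x_{i,S}=1\}$, and let $\mathcal P_{\mathrm{MDM}}(\mathcal S)\subseteq\prod_{S\in\mathcal S}\Delta_S$ be the set of all collections $(p_{i,S}: i\in S,\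 S\in\mathcal S)$ for which there is a single MDM that yields $(p_{i,S})_{i\in S}$ as its choice probabilities for every $S\in\mathcal S$. Then, for every such collection $\mathcal S$, the set $\mathcal P_{\mathrm{MDM}}(\mathcal S)$ has positive measure: $\mu\big(\mathcal P_{\mathrm{MDM}}(\mathcal S)\big)>0$, where $\mu$ is the Lebesgue measure on $\prod_{S\in\mathcal S}\Delta_S$, i.e. the product of the $(|S|-1)$-dimensional Lebesgue measures on the simplices $\Delta_S$ (a unit point mass if $|S|=1$). More precisely, $\mathcal P_{\mathrm{MDM}}(\mathcal S)$ contains a measurable set of positive $\mu$-measure. -/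

import Mathlib

open MeasureTheory ProbabilityTheory

/-- A marginal distribution model on the products `Fin n`: deterministic utilities `ν i`, together
with the prescribed laws of the random terms `ε i`.  Each law is an absolutely continuous
probability measure on `ℝ` with finite first absolute moment, whose distribution function is
strictly increasing on its support. -/
structure MDM (n : ℕ) where
  /-- the deterministic utilities -/
  ν : Fin n → ℝ
  /-- the marginal laws of the random terms -/
  law : Fin n → Measure ℝ
  isProbabilityMeasure : ∀ i, IsProbabilityMeasure (law i)
  absolutelyContinuous : ∀ i, law i ≪ volume
  strictMonoOn_cdf : ∀ i, StrictMonoOn (cdf (law i)) (law i).support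
  integrable_abs : ∀ i, Integrable (fun x : ℝ => |x|) (law i)

namespace MDM

variable {n : ℕ} (M : MDM n)

/-- The joint distributions of `(ε 1, …, ε n)` with the prescribed marginal laws (no assumption on
the dependence). -/
def couplings : Set (Measure (Fin n → ℝ)) :=
  {θ | IsProbabilityMeasure θ ∧ ∀ i, θ.map (fun ε => ε i) = M.law i}

/-- The expected maximal utility over the assortment `S` under the joint law `θ`.
(For `θ ∈ M.couplings` the integrand is integrable, as all `ε i` are.) -/
noncomputable def expectedMaxUtility (S : Finset (Fin n)) (hS : S.Nonempty)
    (θ : Measure (Fin n → ℝ)) : ℝ :=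
  ∫ ε, S.sup' hS (fun i => M.ν i + ε i) ∂θ

/-- `θ` is a joint law with the prescribed marginals which attains the maximal expected utility
over the assortment `S`. -/
def IsOptimal (S : Finset (Fin n)) (hS : S.Nonempty) (θ : Measure (Fin n → ℝ)) : Prop :=
  θ ∈ M.couplings ∧
    ∀ θ' ∈ M.couplings, M.expectedMaxUtility S hS θ' ≤ M.expectedMaxUtility S hS θ

/-- The probability under `θ` that `i` is the (unique) utility maximizing product of `S`. -/
noncomputable def choiceProb (S : Finset (Fin n)) (θ : Measure (Fin n → ℝ)) (i : Fin n) : ℝ :=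
  θ.real {ε | ∀ j ∈ S, j ≠ i → M.ν j + ε j < M.ν i + ε i}

end MDM

/-- Vectors `(x_{i,S} : i ∈ S, S ∈ 𝒮)`. -/
abbrev ChoiceData {n : ℕ} (𝒮 : Finset (Finset (Fin n))) : Type :=
  (S : {S // S ∈ 𝒮}) → EuclideanSpace ℝ {i // i ∈ S.1}

/-- The probability simplex `Δ_S`. -/
def probSimplex {n : ℕ} (S : Finset (Fin n)) : Set (EuclideanSpace ℝ {i // i ∈ S}) :=
  {x | (∀ i, 0 ≤ x i) ∧ ∑ i, x i = 1}

/-- The choice probability collections over `𝒮` which are represented by some marginal distribution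
model: one and the same model has to yield the choice probabilities of all assortments `S ∈ 𝒮`,
those of `S` being evaluated under a joint law that is optimal for `S`. -/
def mdmRepresentable {n : ℕ} (𝒮 : Finset (Finset (Fin n))) (h𝒮 : ∀ S ∈ 𝒮, S.Nonempty) :
    Set (ChoiceData 𝒮) :=
  {p | (∀ S, p S ∈ probSimplex S.1) ∧
    ∃ M : MDM n, ∀ S : {S // S ∈ 𝒮}, ∃ θ : Measure (Fin n → ℝ),
      M.IsOptimal S.1 (h𝒮 S.1 S.2) θ ∧ ∀ i : {i // i ∈ S.1}, p S i = M.choiceProb S.1 θ i.1}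

/-- The space of vectors with coordinate sum `0`, i.e. the direction of the affine hull of `Δ_S`. -/
def sumZero {n : ℕ} (S : Finset (Fin n)) : Submodule ℝ (EuclideanSpace ℝ {i // i ∈ S}) where
  carrier := {v | ∑ i, v i = 0}
  zero_mem' := by simp
  add_mem' := by
    intro a b ha hb
    simp only [Set.mem_ofPred_eq, PiLp.add_apply, Finset.sum_add_distrib] at *
    rw [ha, hb, add_zero]
  smul_mem' := by
    intro c a ha
    simp only [Set.mem_ofPred_eq, PiLp.smul_apply, smul_eq_mul, ← Finset.mul_sum] at *
    rw [ha, mul_zero]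

/-- The barycenter of `Δ_S`. -/
noncomputable def barycenter {n : ℕ} (S : Finset (Fin n)) : EuclideanSpace ℝ {i // i ∈ S} :=
  WithLp.toLp 2 (fun _ => (S.card : ℝ)⁻¹)

/-- The (`|S| - 1`-dimensional) Lebesgue measure on `Δ_S`: the Lebesgue measure of the Euclidean
space `sumZero S` (the Haar measure which gives the unit cube of an orthonormal basis measure `1`),
carried over to the hyperplane `∑ i, x i = 1` by a translation and restricted to `Δ_S`. If `S` has
one element, this is the unit mass at the only point of `Δ_S`. -/
noncomputable def simplexMeasure {n : ℕ} (S : Finset (Fin n)) :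
    Measure (EuclideanSpace ℝ {i // i ∈ S}) :=
  ((stdOrthonormalBasis ℝ (sumZero S)).toBasis.addHaar.map
    (fun v : sumZero S => barycenter S + v.1)).restrict (probSimplex S)

/-- The Lebesgue measure on the product of simplices `∏_{S ∈ 𝒮} Δ_S`. -/
noncomputable def simplexProdMeasure {n : ℕ} (𝒮 : Finset (Finset (Fin n))) :
    Measure (ChoiceData 𝒮) :=
  Measure.pi (fun S : {S // S ∈ 𝒮} => simplexMeasure S.1)

/-! All deterministic utilities are set to 0, and every assortment S gets a utility level t_S. The
maximal utility is at most t + ∑ (ν_i + ε_i - t)⁺, whose expectation depends on the marginals only.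
A coupling under which almost surely exactly one product of S reaches t is therefore optimal, and it
chooses i with probability P(ν_i + ε_i ≥ t). Such a coupling exists once these probabilities are
positive and sum to 1 over S (`exists_isOptimal_choiceProb`).

Hence p is representable as soon as each product has a law with tail value p_{i,S} at t_S for all S
containing i. For positive p this is possible if p_{i,S} strictly decreases in t_S
(`exists_law_of_levelMonotone`).

These are finitely many strict inequalities, so they define an open set. With t_S = ∑_{i ∈ S} 2^i,
the logit probabilities 2^i / t_S satisfy them and lie in the interior of the simplices, so the set
has positive measure there. -/

/-! ### Marginal laws with prescribed tail values -/

/-- The scaled uniform distribution on an interval. -/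
lemma exists_uniform_measure {a b m : ℝ} (hab : a < b) (hm : 0 < m) :
    ∃ μ : Measure ℝ, μ ≪ volume ∧ μ (Set.Icc a b)ᶜ = 0 ∧ μ Set.univ = ENNReal.ofReal m ∧
      ∀ u v, a ≤ u → u < v → v ≤ b → 0 < μ (Set.Ioo u v) := by
  have h0 : (volume : Measure ℝ) (Set.Icc a b) ≠ 0 := by simp [hab]
  have htop : (volume : Measure ℝ) (Set.Icc a b) ≠ ⊤ := by simp
  have : IsProbabilityMeasure (cond (volume : Measure ℝ) (Set.Icc a b)) :=
    cond_isProbabilityMeasure_of_finite h0 htop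
  refine ⟨ENNReal.ofReal m • cond (volume : Measure ℝ) (Set.Icc a b), ?_, ?_, ?_, ?_⟩
  · exact (Measure.smul_absolutelyContinuous).trans cond_absolutelyContinuous
  · have := mem_ae_iff.1 (ae_cond_mem (μ := (volume : Measure ℝ)) (measurableSet_Icc (a := a) (b := b)))
    simp only [Measure.smul_apply, smul_eq_mul, mul_eq_zero]
    exact Or.inr this
  · simp
  · intro u v hu huv hv
    have hsub : Set.Icc a b ∩ Set.Ioo u v = Set.Ioo u v :=
      Set.inter_eq_right.2 fun x hx => ⟨hu.trans hx.1.le, hx.2.le.trans hv⟩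
    rw [Measure.smul_apply, smul_eq_mul, cond_apply measurableSet_Icc, hsub]
    refine ENNReal.mul_pos (by simpa using hm) (mul_ne_zero (ENNReal.inv_ne_zero.2 htop) ?_)
    simpa using huv

/-- Finitely many values of a strictly decreasing tail function are interpolated by an absolutely
continuous measure charging every subinterval of `[a, b]`. -/
lemma exists_measure_tail_eq {ι : Type*} [DecidableEq ι] (x : ι → ℝ) (a : ℝ) (s : Finset ι) :
    ∀ (q : ι → ℝ) (b m : ℝ), a < b → 0 < m → (∀ i ∈ s, a < x i ∧ x i < b ∧ 0 < q i ∧ q i < m) →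
      (∀ i ∈ s, ∀ j ∈ s, i ≠ j → x i ≠ x j) →
      (∀ i ∈ s, ∀ j ∈ s, x i < x j → q j < q i) →
      ∃ μ : Measure ℝ, μ ≪ volume ∧ μ (Set.Icc a b)ᶜ = 0 ∧ μ Set.univ = ENNReal.ofReal m ∧
        (∀ u v, a ≤ u → u < v → v ≤ b → 0 < μ (Set.Ioo u v)) ∧
        ∀ i ∈ s, μ (Set.Ici (x i)) = ENNReal.ofReal (q i) := by
  induction s using Finset.induction_on_max_value x with
  | empty =>
    intro q b m hab hm _ _ _
    obtain ⟨μ, h1, h2, h3, h4⟩ := exists_uniform_measure hab hm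
    exact ⟨μ, h1, h2, h3, h4, by simp⟩
  | insert k s hk hmax ih =>
    intro q b m hab hm hq hinj hanti
    obtain ⟨hak, hkb, hqk, hqm⟩ := hq k (Finset.mem_insert_self _ _)
    have hlt : ∀ i ∈ s, x i < x k := fun i hi => lt_of_le_of_ne (hmax i hi)
      (hinj i (Finset.mem_insert_of_mem hi) k (Finset.mem_insert_self _ _)
        (by rintro rfl; exact hk hi))
    have hqlt : ∀ i ∈ s, q k < q i := fun i hi =>
      hanti i (Finset.mem_insert_of_mem hi) k (Finset.mem_insert_self _ _) (hlt i hi)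
    obtain ⟨μ, h1, h2, h3, h4⟩ := exists_uniform_measure hkb hqk
    -- the induction hypothesis applied to the tail function lowered by `q k`
    have key : ∃ μ' : Measure ℝ, μ' ≪ volume ∧ μ' (Set.Icc a (x k))ᶜ = 0 ∧
        μ' Set.univ = ENNReal.ofReal (m - q k) ∧
        (∀ u v, a ≤ u → u < v → v ≤ x k → 0 < μ' (Set.Ioo u v)) ∧
        ∀ i ∈ s, μ' (Set.Ici (x i)) = ENNReal.ofReal (q i - q k) := by
      refine ih (fun i => q i - q k) (x k) (m - q k) hak (by linarith) ?_ ?_ ?_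
      · intro i hi
        obtain ⟨hai, -, -, him⟩ := hq i (Finset.mem_insert_of_mem hi)
        exact ⟨hai, hlt i hi, sub_pos.2 (hqlt i hi), by linarith⟩
      · exact fun i hi j hj => hinj i (Finset.mem_insert_of_mem hi) j (Finset.mem_insert_of_mem hj)
      · intro i hi j hj hij
        have := hanti i (Finset.mem_insert_of_mem hi) j (Finset.mem_insert_of_mem hj) hij
        linarith
    obtain ⟨μ', h1', h2', h3', h4', h5'⟩ := key
    -- Mass `q k` is spread uniformly to the right of the largest point, the remaining `m - q k` to
    -- its left.
    refine ⟨μ' + μ, ?_, ?_, ?_, ?_, ?_⟩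
    · exact h1'.add_left h1
    · rw [Measure.add_apply, add_eq_zero]
      refine ⟨measure_mono_null ?_ h2', measure_mono_null ?_ h2⟩
      · exact Set.compl_subset_compl.2 (Set.Icc_subset_Icc_right hkb.le)
      · exact Set.compl_subset_compl.2 (Set.Icc_subset_Icc_left hak.le)
    · rw [Measure.add_apply, h3, h3', ← ENNReal.ofReal_add (by linarith) hqk.le]
      simp
    · intro u v hu huv hv
      rw [Measure.add_apply]
      rcases lt_or_ge u (x k) with h | h
      · refine lt_of_lt_of_le (h4' u (min v (x k)) hu (lt_min huv h) (min_le_right _ _)) ?_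
        exact (measure_mono (Set.Ioo_subset_Ioo_right (min_le_left _ _))).trans le_self_add
      · exact lt_of_lt_of_le (h4 u v h huv hv) le_add_self
    · have hfull : ∀ y ≤ x k, μ (Set.Ici y) = ENNReal.ofReal (q k) := by
        intro y hy
        rw [← h3]
        refine measure_eq_measure_of_null_sdiff (Set.subset_univ _) (measure_mono_null ?_ h2)
        exact fun z hz hz' => hz.2 (hy.trans hz'.1)
      intro i hi
      rw [Measure.add_apply]
      rcases Finset.mem_insert.1 hi with rfl | hi
      · rw [hfull _ le_rfl]
        suffices μ' (Set.Ici (x i)) = 0 by rw [this, zero_add]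
        -- `μ'` lives on the interval ending at this point, and absolute continuity excludes an atom
        -- there.
        rw [← Set.Ioi_union_left, measure_union_null_iff]
        refine ⟨measure_mono_null ?_ h2', h1' (by simp)⟩
        exact fun z hz hz' => not_le.2 hz hz'.2
      · rw [hfull _ (hlt i hi).le, h5' i hi,
          ← ENNReal.ofReal_add (sub_pos.2 (hqlt i hi)).le hqk.le, sub_add_cancel]

/-- A probability measure whose tail function takes finitely many prescribed values, with the
properties required of the marginal laws of an `MDM`. -/
lemma exists_law_tail_eq {ι : Type*} [DecidableEq ι] (x q : ι → ℝ) {a b : ℝ} (hab : a < b)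
    (s : Finset ι) (hq : ∀ i ∈ s, a < x i ∧ x i < b ∧ 0 < q i ∧ q i < 1)
    (hinj : ∀ i ∈ s, ∀ j ∈ s, i ≠ j → x i ≠ x j)
    (hanti : ∀ i ∈ s, ∀ j ∈ s, x i < x j → q j < q i) :
    ∃ μ : Measure ℝ, IsProbabilityMeasure μ ∧ μ ≪ volume ∧
      StrictMonoOn (cdf μ) μ.support ∧ Integrable (fun x : ℝ => |x|) μ ∧
      μ.real (Set.Ici a) = 1 ∧ ∀ i ∈ s, μ.real (Set.Ici (x i)) = q i := by
  obtain ⟨μ, h1, h2, h3, h4, h5⟩ := exists_measure_tail_eq x a s q b 1 hab one_pos hq hinj hanti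
  have hprob : IsProbabilityMeasure μ := ⟨by simpa using h3⟩
  have hae : ∀ᵐ y ∂μ, y ∈ Set.Icc a b := mem_ae_iff.2 h2
  have hsupp : μ.support ⊆ Set.Icc a b := Measure.support_subset_of_isClosed isClosed_Icc hae
  refine ⟨μ, hprob, h1, ?_, ?_, ?_, ?_⟩
  · intro u hu v hv huv
    rw [cdf_eq_real, cdf_eq_real, ← Set.Iic_union_Ioc_eq_Iic huv.le,
      measureReal_union (Set.Iic_disjoint_Ioc le_rfl) measurableSet_Ioc, lt_add_iff_pos_right]
    refine ENNReal.toReal_pos (ne_of_gt ?_) (measure_ne_top _ _)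
    exact (h4 u v (hsupp hu).1 huv (hsupp hv).2).trans_le (measure_mono Set.Ioo_subset_Ioc_self)
  · refine Integrable.of_bound (by fun_prop) (max |a| |b|) ?_
    filter_upwards [hae] with y hy
    simpa using abs_le_max_abs_abs hy.1 hy.2
  · rw [measureReal_def, (mem_ae_iff_prob_eq_one measurableSet_Ici).1, ENNReal.toReal_one]
    exact hae.mono fun y hy => hy.1
  · intro i hi
    rw [measureReal_def, h5 i hi, ENNReal.toReal_ofReal (hq i hi).2.2.1.le]

/-! ### Duality and optimal couplings -/

namespace MDM

variable {n : ℕ} (M : MDM n)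

lemma integrable_coord {θ : Measure (Fin n → ℝ)} (hθ : θ ∈ M.couplings) (i : Fin n) :
    Integrable (fun ε : Fin n → ℝ => ε i) θ := by
  have h : Integrable (fun x : ℝ => x) (θ.map fun ε => ε i) := by
    rw [hθ.2 i]
    exact (integrable_norm_iff (by fun_prop)).1 (M.integrable_abs i)
  exact h.comp_measurable (measurable_pi_apply i)

/-- The dual bound `t + ∑ (ν i + ε i - t)⁺` on the maximal utility. -/
noncomputable def dualUtility (S : Finset (Fin n)) (t : ℝ) (ε : Fin n → ℝ) : ℝ :=
  t + ∑ i ∈ S, max (M.ν i + ε i - t) 0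

lemma sup'_le_dualUtility {S : Finset (Fin n)} (hS : S.Nonempty) (t : ℝ) (ε : Fin n → ℝ) :
    S.sup' hS (fun i => M.ν i + ε i) ≤ M.dualUtility S t ε := by
  refine Finset.sup'_le _ _ fun i hi => ?_
  have h := Finset.single_le_sum (f := fun i => max (M.ν i + ε i - t) 0)
    (fun j _ => le_max_right _ _) hi
  have := le_max_left (M.ν i + ε i - t) 0
  simp only [dualUtility] at *
  linarith

lemma sup'_eq_dualUtility {S : Finset (Fin n)} (hS : S.Nonempty) {t : ℝ} {ε : Fin n → ℝ}
    {k : Fin n} (hk : k ∈ S) (hkt : t ≤ M.ν k + ε k)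
    (hlt : ∀ j ∈ S, j ≠ k → M.ν j + ε j < t) :
    S.sup' hS (fun i => M.ν i + ε i) = M.dualUtility S t ε := by
  refine le_antisymm (M.sup'_le_dualUtility hS t ε) ?_
  rw [dualUtility, Finset.sum_eq_single_of_mem k hk, max_eq_left (by linarith)]
  · have := Finset.le_sup' (fun i => M.ν i + ε i) hk
    linarith
  · exact fun j hj hjk => max_eq_right (by linarith [hlt j hj hjk])

lemma integrable_excess {θ : Measure (Fin n → ℝ)} (hθ : θ ∈ M.couplings) (t : ℝ) (i : Fin n) :
    Integrable (fun ε : Fin n → ℝ => max (M.ν i + ε i - t) 0) θ := by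
  have := hθ.1
  exact (((integrable_const _).add (M.integrable_coord hθ i)).sub (integrable_const _)).pos_part

lemma integrable_dualUtility {θ : Measure (Fin n → ℝ)} (hθ : θ ∈ M.couplings)
    (S : Finset (Fin n)) (t : ℝ) : Integrable (M.dualUtility S t) θ := by
  have := hθ.1
  exact (integrable_const _).add (integrable_finsetSum _ fun i _ => M.integrable_excess hθ t i)

/-- Each summand involves a single coordinate, so the value is the same for all couplings. -/
lemma integral_dualUtility {θ : Measure (Fin n → ℝ)} (hθ : θ ∈ M.couplings)
    (S : Finset (Fin n)) (t : ℝ) :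
    ∫ ε, M.dualUtility S t ε ∂θ = t + ∑ i ∈ S, ∫ x, max (M.ν i + x - t) 0 ∂M.law i := by
  have := hθ.1
  simp only [dualUtility]
  rw [integral_add (integrable_const _)
    (integrable_finsetSum _ fun i _ => M.integrable_excess hθ t i),
    integral_finsetSum _ fun i _ => M.integrable_excess hθ t i]
  congr 1
  · simp
  · refine Finset.sum_congr rfl fun i _ => ?_
    rw [← hθ.2 i, integral_map (measurable_pi_apply i).aemeasurable (by fun_prop)]

lemma integrable_sup' {θ : Measure (Fin n → ℝ)} (hθ : θ ∈ M.couplings) {S : Finset (Fin n)}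
    (hS : S.Nonempty) : Integrable (fun ε => S.sup' hS (fun i => M.ν i + ε i)) θ := by
  have := hθ.1
  obtain ⟨k, hk⟩ := id hS
  refine integrable_of_le_of_le (g₁ := fun ε => M.ν k + ε k) (g₂ := M.dualUtility S 0) ?_
    (.of_forall fun ε => Finset.le_sup' (fun i => M.ν i + ε i) hk)
    (.of_forall fun ε => M.sup'_le_dualUtility hS 0 ε)
    ((integrable_const _).add (M.integrable_coord hθ k)) (M.integrable_dualUtility hθ S 0)
  refine Measurable.aestronglyMeasurable ?_
  have h := Finset.measurable_sup' hS (f := fun i (ε : Fin n → ℝ) => M.ν i + ε i)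
    (fun i _ => by fun_prop)
  convert h using 1
  ext ε
  simp [Finset.sup'_apply]

/-- A coupling under which almost surely exactly one utility reaches the level `t` is optimal. -/
lemma isOptimal_of_ae {θ : Measure (Fin n → ℝ)} (hθ : θ ∈ M.couplings) {S : Finset (Fin n)}
    (hS : S.Nonempty) {t : ℝ}
    (h : ∀ᵐ ε ∂θ, ∃ k ∈ S, t ≤ M.ν k + ε k ∧ ∀ j ∈ S, j ≠ k → M.ν j + ε j < t) :
    M.IsOptimal S hS θ := by
  refine ⟨hθ, fun θ' hθ' => ?_⟩
  have hθt : M.expectedMaxUtility S hS θ = ∫ ε, M.dualUtility S t ε ∂θ := by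
    refine integral_congr_ae ?_
    filter_upwards [h] with ε ⟨k, hk, hkt, hlt⟩
    exact M.sup'_eq_dualUtility hS hk hkt hlt
  rw [hθt, M.integral_dualUtility hθ, ← M.integral_dualUtility hθ']
  exact integral_mono (M.integrable_sup' hθ' hS) (M.integrable_dualUtility hθ' S t)
    fun ε => M.sup'_le_dualUtility hS t ε

/-- The independent coupling of the laws conditioned on `k` being the only product of `S` whose
utility reaches the level `t`. -/
noncomputable def levelMeasure (S : Finset (Fin n)) (t : ℝ) (k : Fin n) : Measure (Fin n → ℝ) :=
  Measure.pi fun j => if j ∈ S then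
    if j = k then cond (M.law j) {x | t ≤ M.ν j + x} else cond (M.law j) {x | t ≤ M.ν j + x}ᶜ
  else M.law j

/-- If the probabilities of the utilities reaching the level `t` add up to `1` over `S`, then these
are choice probabilities. -/
lemma exists_isOptimal_choiceProb {S : Finset (Fin n)} (hS : S.Nonempty) (t : ℝ) {p : Fin n → ℝ}
    (hpos : ∀ i ∈ S, 0 < p i) (hsum : ∑ i ∈ S, p i = 1)
    (hlaw : ∀ i ∈ S, (M.law i).real {x | t ≤ M.ν i + x} = p i) :
    ∃ θ, M.IsOptimal S hS θ ∧ ∀ i ∈ S, p i = M.choiceProb S θ i := by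
  have hprob := M.isProbabilityMeasure
  set U : Fin n → Set ℝ := fun j => {x | t ≤ M.ν j + x} with hU
  have hUm : ∀ j, MeasurableSet (U j) := fun j => measurableSet_le (by fun_prop) (by fun_prop)
  have hUp : ∀ j ∈ S, M.law j (U j) = ENNReal.ofReal (p j) := fun j hj => by
    rw [← hlaw j hj, ofReal_measureReal]
  -- The probability of missing the level is the total weight of the other products, which makes the
  -- mixture below have the right marginals.
  have hUcp : ∀ j ∈ S, M.law j (U j)ᶜ = ENNReal.ofReal (∑ k ∈ S.erase j, p k) := fun j hj => by
    rw [prob_compl_eq_one_sub (hUm j), hUp j hj, ← ENNReal.ofReal_one,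
      ← ENNReal.ofReal_sub _ (hpos j hj).le, ← hsum, ← Finset.add_sum_erase S p hj]
    simp
  set κ : Fin n → Fin n → Measure ℝ := fun k j => if j ∈ S then
    if j = k then cond (M.law j) (U j) else cond (M.law j) (U j)ᶜ else M.law j with hκ
  have hκp : ∀ k ∈ S, ∀ j, IsProbabilityMeasure (κ k j) := by
    intro k hk j
    simp only [hκ]
    split_ifs with hj hjk
    · exact cond_isProbabilityMeasure (by rw [hUp j hj]; simpa using hpos j hj)
    · refine cond_isProbabilityMeasure ?_
      rw [hUcp j hj, ne_eq, ENNReal.ofReal_eq_zero, not_le]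
      exact Finset.sum_pos (fun i hi => hpos i (Finset.mem_of_mem_erase hi))
        ⟨k, Finset.mem_erase.2 ⟨Ne.symm hjk, hk⟩⟩
    · infer_instance
  have hmap : ∀ k ∈ S, ∀ j, MeasurePreserving (Function.eval j) (M.levelMeasure S t k) (κ k j) :=
    fun k hk j => by
      have := hκp k hk
      exact measurePreserving_eval (κ k) j
  have hlp : ∀ k ∈ S, IsProbabilityMeasure (M.levelMeasure S t k) := fun k hk => by
    have := hκp k hk
    exact inferInstanceAs (IsProbabilityMeasure (Measure.pi (κ k)))
  have hae : ∀ k ∈ S, ∀ᵐ ε ∂M.levelMeasure S t k,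
      t ≤ M.ν k + ε k ∧ ∀ j ∈ S, j ≠ k → M.ν j + ε j < t := by
    intro k hk
    have h1 : ∀ᵐ ε ∂M.levelMeasure S t k, ε k ∈ U k :=
      (hmap k hk k).quasiMeasurePreserving.ae (p := (· ∈ U k)) (by
        simp only [hκ, hk, if_true]; exact ae_cond_mem (hUm k))
    have h2 : ∀ᵐ ε ∂M.levelMeasure S t k, ∀ j ∈ S, j ≠ k → ε j ∈ (U j)ᶜ := by
      rw [ae_all_iff]; intro j
      rw [ae_all_iff]; intro hj
      rw [ae_all_iff]; intro hjk
      exact (hmap k hk j).quasiMeasurePreserving.ae (p := (· ∈ (U j)ᶜ)) (by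
        simp only [hκ, hj, hjk, if_true, if_false]; exact ae_cond_mem (hUm j).compl)
    filter_upwards [h1, h2] with ε h1 h2
    exact ⟨h1, fun j hj hjk => not_le.1 (h2 j hj hjk)⟩
  -- Draw the product k that reaches the level with probability `p k`, then draw the utilities
  -- accordingly.
  set θ : Measure (Fin n → ℝ) := ∑ k ∈ S, ENNReal.ofReal (p k) • M.levelMeasure S t k with hθdef
  have hofsum : ∑ k ∈ S, ENNReal.ofReal (p k) = 1 := by
    rw [← ENNReal.ofReal_sum_of_nonneg fun i hi => (hpos i hi).le, hsum, ENNReal.ofReal_one]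
  have hθapp : ∀ B, θ B = ∑ k ∈ S, ENNReal.ofReal (p k) * M.levelMeasure S t k B := fun B => by
    simp [hθdef, Measure.finsetSum_apply]
  have hθ : θ ∈ M.couplings := by
    refine ⟨⟨?_⟩, fun j => ?_⟩
    · rw [hθapp, ← hofsum]
      refine Finset.sum_congr rfl fun k hk => ?_
      have := hlp k hk
      simp
    · ext B hB
      rw [Measure.map_apply (measurable_pi_apply j) hB, hθapp]
      have h : ∀ k ∈ S, M.levelMeasure S t k ((fun ε => ε j) ⁻¹' B) = κ k j B := fun k hk =>
        (hmap k hk j).measure_preimage hB.nullMeasurableSet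
      rw [Finset.sum_congr rfl fun k hk => by rw [h k hk]]
      by_cases hj : j ∈ S
      -- Law of total probability: the component k = j gives the law conditioned on `U j`, all the
      -- others the law conditioned on its complement.
      · rw [← Finset.add_sum_erase S _ hj,
          Finset.sum_congr rfl (g := fun k => ENNReal.ofReal (p k) * (cond (M.law j) (U j)ᶜ B)),
          ← Finset.sum_mul, ← ENNReal.ofReal_sum_of_nonneg
            fun i hi => (hpos i (Finset.mem_of_mem_erase hi)).le, ← hUcp j hj, ← hUp j hj]
        · simp only [hκ, hj, if_true]
          rw [mul_comm, mul_comm (M.law j (U j)ᶜ), cond_add_cond_compl_eq (hUm j)]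
        · intro k hk
          simp only [hκ, hj, if_true, if_neg (Finset.ne_of_mem_erase hk).symm]
      · simp only [hκ, hj, if_false]
        rw [← Finset.sum_mul, hofsum, one_mul]
  refine ⟨θ, M.isOptimal_of_ae hθ hS (t := t) ?_, fun i hi => ?_⟩
  · rw [hθdef, ae_finsetSum_measure_iff]
    intro k hk
    refine Measure.ae_smul_measure ?_ _
    filter_upwards [hae k hk] with ε hε
    exact ⟨k, hk, hε⟩
  · rw [choiceProb, measureReal_def, hθapp, Finset.sum_eq_single_of_mem i hi]
    · have := hlp i hi
      have h : M.levelMeasure S t i {ε | ∀ j ∈ S, j ≠ i → M.ν j + ε j < M.ν i + ε i} = 1 := by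
        refine (measure_congr (Filter.eventuallyEq_univ.2 ?_)).trans measure_univ
        filter_upwards [hae i hi] with ε hε j hj hji
        exact (hε.2 j hj hji).trans_le hε.1
      rw [h, mul_one, ENNReal.toReal_ofReal (hpos i hi).le]
    · intro k hk hki
      suffices h : M.levelMeasure S t k {ε | ∀ j ∈ S, j ≠ i → M.ν j + ε j < M.ν i + ε i} = 0 by
        rw [h, mul_zero]
      refine measure_eq_zero_iff_ae_notMem.2 ?_
      filter_upwards [hae k hk] with ε hε h
      exact lt_asymm (h k hk hki) ((hε.2 i hi hki.symm).trans_le hε.1)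

end MDM

/-! ### Lebesgue measure on the product of simplices -/

variable {n : ℕ}

/-- Needed to evaluate the product measure on boxes. -/
instance sigmaFinite_simplexMeasure (S : Finset (Fin n)) : SigmaFinite (simplexMeasure S) := by
  have hemb : MeasurableEmbedding (fun v : sumZero S => barycenter S + v.1) :=
    ((Homeomorph.addLeft (barycenter S)).isClosedEmbedding.comp
      (sumZero S).closed_of_finiteDimensional.isClosedEmbedding_subtypeVal).measurableEmbedding
  have := hemb.sigmaFinite_map (μ := (stdOrthonormalBasis ℝ (sumZero S)).toBasis.addHaar)
  unfold simplexMeasure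
  infer_instance

lemma measurableSet_probSimplex (S : Finset (Fin n)) : MeasurableSet (probSimplex S) := by
  have h : probSimplex S = (⋂ i, {x | 0 ≤ x i}) ∩ {x | ∑ i, x i = 1} := by
    ext x; simp [probSimplex]
  rw [h]
  refine (IsClosed.inter (isClosed_iInter fun i => isClosed_le (by fun_prop) (by fun_prop))
    (isClosed_eq (by fun_prop) (by fun_prop))).measurableSet

/-- The Lebesgue measure on the simplex charges all neighbourhoods of its interior points. -/
lemma simplexMeasure_inter_probSimplex_pos {S : Finset (Fin n)}
    {U : Set (EuclideanSpace ℝ {i // i ∈ S})} (hU : IsOpen U)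
    {x : EuclideanSpace ℝ {i // i ∈ S}} (hxU : x ∈ U) (hpos : ∀ i, 0 < x i)
    (hsum : ∑ i, x i = 1) : 0 < simplexMeasure S (U ∩ probSimplex S) := by
  have hS : (S.card : ℝ) ≠ 0 := by
    rintro h
    have : IsEmpty {i // i ∈ S} := by
      rw [Finset.card_eq_zero.1 (Nat.cast_eq_zero.1 h)]; infer_instance
    simp at hsum
  have hbar : ∑ i, barycenter S i = 1 := by
    simp [barycenter, hS]
  have hcont : Continuous (fun v : sumZero S => barycenter S + v.1) := by fun_prop
  set V : Set (sumZero S) :=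
    (fun v : sumZero S => barycenter S + v.1) ⁻¹' (U ∩ ⋂ i, {y | 0 < y i}) with hV
  have hVo : IsOpen V := IsOpen.preimage hcont
    (hU.inter (isOpen_iInter_of_finite fun i => isOpen_lt (by fun_prop) (by fun_prop)))
  have hmem : x - barycenter S ∈ sumZero S := by
    change ∑ i, (x - barycenter S) i = 0
    simp only [PiLp.sub_apply, Finset.sum_sub_distrib, hsum, hbar, sub_self]
  have hne : V.Nonempty := ⟨⟨x - barycenter S, hmem⟩, by simp [hV, hxU, hpos]⟩
  refine (hVo.measure_pos (stdOrthonormalBasis ℝ (sumZero S)).toBasis.addHaar hne).trans_le ?_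
  refine le_trans (measure_mono ?_) ((Measure.le_map_apply hcont.measurable.aemeasurable _).trans
    (Measure.le_restrict_apply _ _))
  rintro v ⟨hvU, hvpos⟩
  have hvpos' : ∀ i, 0 < (barycenter S + v.1) i := by simpa using hvpos
  have hv : ∑ i, v.1 i = 0 := v.2
  have hΔ : barycenter S + v.1 ∈ probSimplex S := by
    refine ⟨fun i => (hvpos' i).le, ?_⟩
    simp only [PiLp.add_apply, Finset.sum_add_distrib, hbar, hv, add_zero]
  exact ⟨⟨hvU, hΔ⟩, hΔ⟩

/-- A relatively open property of choice data holds on a measurable set of positive measure as soon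
as it holds at one point in the interior of the product of simplices. -/
lemma exists_measurableSet_simplexProdMeasure_pos {𝒮 : Finset (Finset (Fin n))}
    {D : Set (ChoiceData 𝒮)} (hD : IsOpen D) {p : ChoiceData 𝒮} (hpD : p ∈ D)
    (hpos : ∀ S i, 0 < p S i) (hsum : ∀ S, ∑ i, p S i = 1) :
    ∃ A ⊆ D, (∀ q ∈ A, ∀ S, q S ∈ probSimplex S.1) ∧ MeasurableSet A ∧
      0 < simplexProdMeasure 𝒮 A := by
  obtain ⟨u, hu, huD⟩ := isOpen_pi_iff'.1 hD p hpD
  refine ⟨Set.univ.pi fun S => u S ∩ probSimplex S.1, ?_, ?_, ?_, ?_⟩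
  · exact (Set.pi_mono fun S _ => Set.inter_subset_left).trans huD
  · exact fun q hq S => (hq S trivial).2
  · exact MeasurableSet.univ_pi fun S =>
      (hu S).1.measurableSet.inter (measurableSet_probSimplex S.1)
  · rw [simplexProdMeasure, Measure.pi_pi]
    exact CanonicallyOrderedAdd.prod_pos.2 fun S _ =>
      simplexMeasure_inter_probSimplex_pos (hu S).1 (hu S).2 (hpos S) (hsum S)

/-! ### Levels and the logit point -/

/-- The binary code of an assortment, which serves as its utility level. -/
def level (S : Finset (Fin n)) : ℝ := ∑ i ∈ S, 2 ^ (i : ℕ)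

/-- Uniqueness of binary expansions; distinct assortments thus prescribe tail values at distinct
points. -/
lemma level_injective : Function.Injective (level (n := n)) := by
  intro S T h
  have h' : ∑ i ∈ S, 2 ^ (i : ℕ) = ∑ i ∈ T, 2 ^ (i : ℕ) := by
    simp only [level] at h
    exact_mod_cast h
  refine Finset.map_injective Fin.valEmbedding (Finset.geomSum_injective le_rfl ?_)
  simpa using h'

lemma level_mono {S T : Finset (Fin n)} (h : S ⊆ T) : level S ≤ level T :=
  Finset.sum_le_sum_of_subset_of_nonneg h fun _ _ _ => by positivity

lemma level_pos {S : Finset (Fin n)} (hS : S.Nonempty) : 0 < level S :=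
  Finset.sum_pos (fun _ _ => by positivity) hS

/-- Positive choice data for which every product is chosen less often from assortments of higher
level. -/
def levelMonotone (𝒮 : Finset (Finset (Fin n))) : Set (ChoiceData 𝒮) :=
  {p | (∀ S i, 0 < p S i) ∧ ∀ (S T : {S // S ∈ 𝒮}) (i : Fin n) (hS : i ∈ S.1) (hT : i ∈ T.1),
    level S.1 < level T.1 → p T ⟨i, hT⟩ < p S ⟨i, hS⟩}

lemma isOpen_levelMonotone (𝒮 : Finset (Finset (Fin n))) : IsOpen (levelMonotone 𝒮) := by
  simp only [levelMonotone, Set.ofPred_and, Set.ofPred_forall]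
  refine IsOpen.inter ?_ ?_
  · exact isOpen_iInter_of_finite fun S => isOpen_iInter_of_finite fun i =>
      isOpen_lt (by fun_prop) (by fun_prop)
  · exact isOpen_iInter_of_finite fun S => isOpen_iInter_of_finite fun T =>
      isOpen_iInter_of_finite fun i => isOpen_iInter_of_finite fun hS =>
      isOpen_iInter_of_finite fun hT => isOpen_iInter_of_finite fun _ =>
      isOpen_lt (by fun_prop) (by fun_prop)

/-- The multinomial logit choice probabilities with weights `2 ^ i`. -/
noncomputable def logitChoice (𝒮 : Finset (Finset (Fin n))) : ChoiceData 𝒮 :=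
  fun S => WithLp.toLp 2 fun i => 2 ^ (i.1 : ℕ) / level S.1

lemma logitChoice_mem_levelMonotone {𝒮 : Finset (Finset (Fin n))} :
    logitChoice 𝒮 ∈ levelMonotone 𝒮 := by
  refine ⟨fun S i => ?_, fun S T i hS hT h => ?_⟩
  · exact div_pos (by positivity) (level_pos ⟨i.1, i.2⟩)
  · exact div_lt_div_of_pos_left (by positivity) (level_pos ⟨i, hS⟩) h

lemma sum_logitChoice {𝒮 : Finset (Finset (Fin n))} (S : {S // S ∈ 𝒮}) (hS : S.1.Nonempty) :
    ∑ i, logitChoice 𝒮 S i = 1 := by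
  simp only [logitChoice, ← Finset.sum_div]
  rw [Finset.sum_coe_sort S.1 (fun i => (2 : ℝ) ^ (i : ℕ))]
  exact div_self (level_pos hS).ne'

/-! ### Representation of level monotone data -/

/-- The probability of choosing `i` from `S`, extended by `0` to `i ∉ S`. -/
noncomputable def extendedChoice {𝒮 : Finset (Finset (Fin n))} (p : ChoiceData 𝒮)
    (S : {S // S ∈ 𝒮}) (i : Fin n) : ℝ :=
  if h : i ∈ S.1 then p S ⟨i, h⟩ else 0

lemma extendedChoice_of_mem {𝒮 : Finset (Finset (Fin n))} (p : ChoiceData 𝒮)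
    {S : {S // S ∈ 𝒮}} {i : Fin n} (h : i ∈ S.1) : extendedChoice p S i = p S ⟨i, h⟩ :=
  dif_pos h

lemma sum_extendedChoice {𝒮 : Finset (Finset (Fin n))} (p : ChoiceData 𝒮) (S : {S // S ∈ 𝒮}) :
    ∑ i ∈ S.1, extendedChoice p S i = ∑ i, p S i := by
  rw [← Finset.sum_coe_sort]
  exact Finset.sum_congr rfl fun i _ => extendedChoice_of_mem p i.2

lemma exists_law_of_levelMonotone {𝒮 : Finset (Finset (Fin n))} {p : ChoiceData 𝒮}
    (hp : p ∈ levelMonotone 𝒮) (hΔ : ∀ S, p S ∈ probSimplex S.1) (i : Fin n) :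
    ∃ μ : Measure ℝ, IsProbabilityMeasure μ ∧ μ ≪ volume ∧
      StrictMonoOn (cdf μ) μ.support ∧ Integrable (fun x : ℝ => |x|) μ ∧
      ∀ S : {S // S ∈ 𝒮}, i ∈ S.1 → μ.real (Set.Ici (level S.1)) = extendedChoice p S i := by
  classical
  have hsum : ∀ S, ∑ j ∈ S.1, extendedChoice p S j = 1 := fun S =>
    (sum_extendedChoice p S).trans (hΔ S).2
  have hpos : ∀ S, ∀ j ∈ S.1, 0 < extendedChoice p S j := fun S j hj => by
    rw [extendedChoice_of_mem p hj]; exact hp.1 S _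
  have hbound : ∀ T : Finset (Fin n), level T < level (Finset.univ : Finset (Fin n)) + 1 :=
    fun T => lt_add_of_le_of_pos (level_mono (Finset.subset_univ T)) one_pos
  -- The singleton `{i}` is set apart because its choice probability is 1. It has the lowest level
  -- among assortments containing `i`, so that level serves as the left endpoint of the interval
  -- carrying the law, where the tail is 1.
  have hmem : ∀ S ∈ Finset.univ.filter fun S : {S // S ∈ 𝒮} => i ∈ S.1 ∧ S.1 ≠ {i},
      i ∈ S.1 ∧ S.1 ≠ {i} := fun S hS => (Finset.mem_filter.1 hS).2
  have hq : ∀ S ∈ Finset.univ.filter fun S : {S // S ∈ 𝒮} => i ∈ S.1 ∧ S.1 ≠ {i},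
      level {i} < level S.1 ∧ level S.1 < level (Finset.univ : Finset (Fin n)) + 1 ∧
        0 < extendedChoice p S i ∧ extendedChoice p S i < 1 := by
    intro S hS
    obtain ⟨hiS, hSi⟩ := hmem S hS
    refine ⟨lt_of_le_of_ne (level_mono (by simpa using hiS))
      fun h => hSi (level_injective h).symm,
      hbound _, hpos S i hiS, ?_⟩
    obtain ⟨j, hj, hji⟩ : ∃ j ∈ S.1, j ≠ i := by
      by_contra! h
      exact hSi (Finset.eq_singleton_iff_unique_mem.2 ⟨hiS, h⟩)
    rw [← hsum S]
    exact Finset.single_lt_sum hji hiS hj (hpos S j hj) fun k hk _ => (hpos S k hk).le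
  obtain ⟨μ, h1, h2, h3, h4, h5, h6⟩ := exists_law_tail_eq
    (fun S : {S // S ∈ 𝒮} => level S.1) (fun S => extendedChoice p S i)
    (hbound {i}) _ hq
    (fun S _ T _ hST h => hST (Subtype.ext (level_injective h)))
    (fun S hS T hT hST => by
      simp only [extendedChoice_of_mem p (hmem S hS).1, extendedChoice_of_mem p (hmem T hT).1]
      exact hp.2 S T i _ _ hST)
  refine ⟨μ, h1, h2, h3, h4, fun S hS => ?_⟩
  by_cases hSi : S.1 = {i}
  · have := hsum S
    rw [hSi, Finset.sum_singleton] at this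
    rw [hSi, h5, this]
  · exact h6 S (by simp [hS, hSi])

/-- Level monotone choice data are represented by a marginal distribution model with zero
deterministic utilities. -/
lemma mem_mdmRepresentable_of_levelMonotone {𝒮 : Finset (Finset (Fin n))}
    (h𝒮 : ∀ S ∈ 𝒮, S.Nonempty) {p : ChoiceData 𝒮} (hp : p ∈ levelMonotone 𝒮)
    (hΔ : ∀ S, p S ∈ probSimplex S.1) : p ∈ mdmRepresentable 𝒮 h𝒮 := by
  choose μ h1 h2 h3 h4 h5 using exists_law_of_levelMonotone hp hΔ
  let M : MDM n := ⟨0, μ, h1, h2, h3, h4⟩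
  refine ⟨hΔ, M, fun S => ?_⟩
  obtain ⟨θ, hθ, hθp⟩ := M.exists_isOptimal_choiceProb (h𝒮 S.1 S.2) (level S.1)
    (p := extendedChoice p S)
    (fun i hi => by rw [extendedChoice_of_mem p hi]; exact hp.1 S _)
    ((sum_extendedChoice p S).trans (hΔ S).2)
    (fun i hi => by
      rw [← h5 i S hi]
      simp only [M, Pi.zero_apply, zero_add]
      rfl)
  exact ⟨θ, hθ, fun i => by rw [← hθp i.1 i.2, extendedChoice_of_mem p i.2]⟩

theorem theorem2 (n : ℕ) (𝒮 : Finset (Finset (Fin n))) (h𝒮 : ∀ S ∈ 𝒮, S.Nonempty) :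
    0 < simplexProdMeasure 𝒮 (mdmRepresentable 𝒮 h𝒮) ∧
      ∃ A ⊆ mdmRepresentable 𝒮 h𝒮, MeasurableSet A ∧ 0 < simplexProdMeasure 𝒮 A := by
  obtain ⟨A, hAD, hAΔ, hAm, hApos⟩ := exists_measurableSet_simplexProdMeasure_pos
    (isOpen_levelMonotone 𝒮) logitChoice_mem_levelMonotone logitChoice_mem_levelMonotone.1
    fun S => sum_logitChoice S (h𝒮 S.1 S.2)
  have hA : A ⊆ mdmRepresentable 𝒮 h𝒮 := fun p hp =>
    mem_mdmRepresentable_of_levelMonotone h𝒮 (hAD hp) (hAΔ p hp)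
  exact ⟨hApos.trans_le (measure_mono hA), A, hA, hAm, hApos⟩
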